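/- For positive integers $i_1,\dots,i_k$ with $i_1\ge 2$ put \[ \zeta(i_1,\dots,i_k)=\sum_{n_1>n_2>\cdots>n_k\ge 1}\frac{1}{n_1^{i_1}n_2^{i_2}\cdots n_k^{i_k}}, \qquad t(i_1,\dots,i_k)=\sum_{\substack{n_1>n_2>\cdots>n_k\ge 1\\ n_j\ \mathrm{odd}}}\frac{1}{n_1^{i_1}n_2^{i_2}\cdots n_k^{i_k}}, \] the sums running over $k$-tuples of integers, and let $\{2\}^n=(2,2,\dots,2)$ ($n$ entries). Then, for every integer $n\ge 1$, the series defining $\zeta(\{2\}^n)$ and $t(\{2\}^n)$ converge, and \[ \frac{\zeta(\{2\}^n)}{2^{2n}}=\frac{1}{(2n+1)!}\left(\frac{\pi}{2}\right)^{2n}, \qquad t(\{2\}^n)=\frac{1}{(2n)!}\left(\frac{\pi}{2}\right)^{2n}. \] -/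

import Mathlib

namespace MultipleValues

/-- The tuples `(n₁, …, n_k)` of positive integers with `n₁ > n₂ > ⋯ > n_k`. -/
def decreasingTuples (k : ℕ) : Set (Fin k → ℕ) :=
  {m | StrictAnti m ∧ ∀ j, 0 < m j}

/-- The tuples `(n₁, …, n_k)` of odd positive integers with `n₁ > n₂ > ⋯ > n_k`. -/
def oddDecreasingTuples (k : ℕ) : Set (Fin k → ℕ) :=
  {m | StrictAnti m ∧ ∀ j, Odd (m j)}

/-- The summand `1 / (n₁ ^ i₁ * n₂ ^ i₂ * ⋯ * n_k ^ i_k)`. -/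
noncomputable def summand {k : ℕ} (i m : Fin k → ℕ) : ℝ :=
  1 / ∏ j, (m j : ℝ) ^ i j

/-- The multiple zeta value `ζ(i₁, …, i_k)`. -/
noncomputable def multipleZeta {k : ℕ} (i : Fin k → ℕ) : ℝ :=
  ∑' m : decreasingTuples k, summand i m

/-- The multiple `t`-value `t(i₁, …, i_k)`. -/
noncomputable def multipleT {k : ℕ} (i : Fin k → ℕ) : ℝ :=
  ∑' m : oddDecreasingTuples k, summand i m

/-- The constant index `{a}ⁿ = (a, a, …, a)` of length `n`. -/
def repeated (a n : ℕ) : Fin n → ℕ := fun _ => a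

end MultipleValues

open Filter Topology

namespace MultipleValues

/-! Expanding `∏ (1 + x / k ^ 2)` over `k ∈ S`, the coefficient of `x ^ n` is the sum over strictly
decreasing `n`-tuples from `S` (`hasSum_summand_two`). With `x = z ^ 2`, Euler's product gives `sinh
(π z) / (π z)` for the positive integers and `cosh (π z / 2)` for the odd ones. Uniqueness of Taylor
coefficients at 0 then yields both values, and absolute convergence of `∑ 1 / k ^ 2` gives
summability. -/

lemma powerSeries_coeff_unique {c d : ℕ → ℂ} {f : ℂ → ℂ}
    (hc : ∀ᶠ x in 𝓝 0, HasSum (fun n ↦ c n * x ^ n) (f x))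
    (hd : ∀ᶠ x in 𝓝 0, HasSum (fun n ↦ d n * x ^ n) (f x)) : c = d := by
  have key : ∀ e : ℕ → ℂ, (∀ᶠ x in 𝓝 0, HasSum (fun n ↦ e n * x ^ n) (f x)) →
      HasFPowerSeriesAt f (FormalMultilinearSeries.ofScalars ℂ e) 0 := by
    intro e he
    rw [hasFPowerSeriesAt_iff]
    filter_upwards [he] with x hx
    simpa [FormalMultilinearSeries.coeff_ofScalars, mul_comm] using hx
  have h := (key c hc).eq_formalMultilinearSeries (key d hd)
  ext n
  simpa [FormalMultilinearSeries.coeff_ofScalars] using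
    congrArg (fun p : FormalMultilinearSeries ℂ ℂ ℂ ↦ p.coeff n) h

/-- The elementary symmetric sums of `a` are the Taylor coefficients of `∏ (1 + x a i)`. -/
lemma hasSum_prod_card_eq {ι : Type*} {a : ι → ℂ} (ha : Summable fun i ↦ ‖a i‖) {d : ℕ → ℂ}
    (hd : ∀ᶠ x in 𝓝 0, HasSum (fun n ↦ d n * x ^ n) (∏' i, (1 + x * a i))) (n : ℕ) :
    HasSum (fun s : (Finset.card ⁻¹' {n} : Set (Finset ι)) ↦ ∏ i ∈ (s : Finset ι), a i) (d n) := by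
  have hs : Summable fun s : Finset ι ↦ ∏ i ∈ s, a i := summable_finsetProd_of_summable_norm ha
  have key : (fun n ↦ ∑' s : (Finset.card ⁻¹' {n} : Set (Finset ι)),
      ∏ i ∈ (s : Finset ι), a i) = d := by
    refine powerSeries_coeff_unique (.of_forall fun x ↦ ?_) hd
    have hx : Summable fun s : Finset ι ↦ ∏ i ∈ s, x * a i :=
      summable_finsetProd_of_summable_norm (by simpa using ha.mul_left ‖x‖)
    rw [tprod_one_add hx]
    convert! hx.hasSum.tsum_fiberwise Finset.card using 2 with k
    rw [← tsum_mul_right]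
    refine tsum_congr fun s ↦ ?_
    rw [Finset.prod_mul_distrib, Finset.prod_const, show (s : Finset ι).card = k from s.2, mul_comm]
  rw [← key]
  exact (hs.subtype _).hasSum

/-- A decreasing tuple is determined by its set of values, and every `n`-element subset of `S`
arises this way; sets not contained in `S` contribute zero. -/
lemma hasSum_strictAnti_tuples {S : Set ℕ} {a : ℕ → ℂ} (ha : ∀ i ∉ S, a i = 0) {n : ℕ} {v : ℂ}
    (h : HasSum (fun s : (Finset.card ⁻¹' {n} : Set (Finset ℕ)) ↦
      ∏ i ∈ (s : Finset ℕ), a i) v) :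
    HasSum (fun m : {m : Fin n → ℕ | StrictAnti m ∧ ∀ j, m j ∈ S} ↦
      ∏ j, a ((m : Fin n → ℕ) j)) v := by
  let e : {m : Fin n → ℕ | StrictAnti m ∧ ∀ j, m j ∈ S} →
      (Finset.card ⁻¹' {n} : Set (Finset ℕ)) := fun m ↦
    ⟨Finset.univ.image (m : Fin n → ℕ), by
      simp [Finset.card_image_of_injective _ m.2.1.injective]⟩
  have he : Function.Injective e := by
    intro m m' hm
    have hm' : Set.range (m : Fin n → ℕ) = Set.range (m' : Fin n → ℕ) := by
      have := congrArg (fun s ↦ ((s : Finset ℕ) : Set ℕ)) (Subtype.ext_iff.mp hm)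
      simpa [e] using this
    have h1 : StrictMono ((m : Fin n → ℕ) ∘ Fin.rev) := m.2.1.comp Fin.rev_strictAnti
    have h2 : StrictMono ((m' : Fin n → ℕ) ∘ Fin.rev) := m'.2.1.comp Fin.rev_strictAnti
    have h3 := (h1.range_inj h2).mp (by
      rw [Fin.rev_surjective.range_comp, Fin.rev_surjective.range_comp, hm'])
    exact Subtype.ext (Fin.rev_surjective.injective_comp_right h3)
  have hsupp : ∀ s ∉ Set.range e, ∏ i ∈ (s : Finset ℕ), a i = 0 := by
    rintro ⟨s, hs : s.card = n⟩ hse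
    by_contra h0
    have hS : ∀ i ∈ s, i ∈ S := fun i hi ↦ by
      by_contra hiS
      exact h0 (Finset.prod_eq_zero hi (ha i hiS))
    refine hse ⟨⟨s.orderEmbOfFin hs ∘ Fin.rev,
      (s.orderEmbOfFin hs).strictMono.comp_strictAnti Fin.rev_strictAnti,
      fun j ↦ hS _ (s.orderEmbOfFin_mem hs _)⟩, Subtype.ext ?_⟩
    rw [← Finset.coe_inj]
    simp only [e, Finset.coe_image, Finset.coe_univ, Set.image_univ]
    rw [Fin.rev_surjective.range_comp, Finset.range_orderEmbOfFin]
  rw [← he.hasSum_iff hsupp] at h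
  convert h using 2 with m
  exact (Finset.prod_image m.2.1.injective.injOn).symm

lemma summable_norm_indicator_inv_sq (S : Set ℕ) :
    Summable fun i ↦ ‖S.indicator (fun k : ℕ ↦ 1 / (k : ℂ) ^ 2) i‖ := by
  have h : Summable fun k : ℕ ↦ ‖1 / (k : ℂ) ^ 2‖ := by
    simp
  simpa only [norm_indicator_eq_indicator_norm]
    using h.indicator S

lemma hasSum_summand_two {S : Set ℕ} {d : ℕ → ℝ}
    (hd : ∀ᶠ x in 𝓝 (0 : ℂ), HasSum (fun n ↦ (d n : ℂ) * x ^ n)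
      (∏' i, (1 + x * S.indicator (fun k : ℕ ↦ 1 / (k : ℂ) ^ 2) i))) (n : ℕ) :
    HasSum (fun m : {m : Fin n → ℕ | StrictAnti m ∧ ∀ j, m j ∈ S} ↦
      summand (repeated 2 n) m) (d n) := by
  have h := hasSum_strictAnti_tuples (S := S) (fun i hi ↦ Set.indicator_of_notMem hi _)
    (hasSum_prod_card_eq (summable_norm_indicator_inv_sq S) hd n)
  rw [← Complex.hasSum_ofReal]
  convert h using 2 with m
  simp [summand, repeated, Set.indicator_of_mem (m.2.2 _)]

lemma multipliable_one_add_indicator_inv_sq (S : Set ℕ) (x : ℂ) :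
    Multipliable fun i ↦ 1 + x * S.indicator (fun k : ℕ ↦ 1 / (k : ℂ) ^ 2) i :=
  multipliable_one_add_of_summable
    (by simpa only [norm_mul] using (summable_norm_indicator_inv_sq S).mul_left ‖x‖)

lemma multipliable_one_add_inv_sq (x : ℂ) :
    Multipliable fun i : ℕ ↦ 1 + x * (1 / (i : ℂ) ^ 2) := by
  simpa using multipliable_one_add_indicator_inv_sq Set.univ x

/-- Euler's product for the hyperbolic sine. -/
lemma pi_mul_tprod_one_add_inv_sq (z : ℂ) :
    Real.pi * z * ∏' i : ℕ, (1 + z ^ 2 * (1 / (i : ℂ) ^ 2)) = Complex.sinh (Real.pi * z) := by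
  have h1 := (Complex.tendsto_euler_sin_prod (z * Complex.I)).mul_const (-Complex.I)
  have h2 : Tendsto (fun n : ℕ ↦ Real.pi * z *
      ∏ i ∈ Finset.range (n + 1), (1 + z ^ 2 * (1 / (i : ℂ) ^ 2))) atTop
      (𝓝 (Real.pi * z * ∏' i : ℕ, (1 + z ^ 2 * (1 / (i : ℂ) ^ 2)))) :=
    (((multipliable_one_add_inv_sq (z ^ 2)).hasProd.tendsto_prod_nat).comp
      (tendsto_add_atTop_nat 1)).const_mul _
  have h3 := tendsto_nhds_unique h2 (h1.congr fun n ↦ ?_)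
  · rw [h3, ← mul_assoc, Complex.sin_mul_I, mul_assoc]
    simp
  -- The factor at `i = 0` is 1, since `1 / 0 = 0`; hence the range `n + 1`.
  · rw [Finset.prod_range_succ']
    simp only [mul_pow, Complex.I_sq, Nat.cast_zero, Nat.cast_add, Nat.cast_one]
    have : ∀ j : ℕ, 1 - z ^ 2 * -1 / ((j : ℂ) + 1) ^ 2 = 1 + z ^ 2 * (1 / ((j : ℂ) + 1) ^ 2) :=
      fun j ↦ by ring
    simp only [this]
    linear_combination (-Real.pi * z * ∏ j ∈ Finset.range n,
      (1 + z ^ 2 * (1 / ((j : ℂ) + 1) ^ 2))) * Complex.I_sq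

lemma indicator_pos_inv_sq :
    {k : ℕ | 0 < k}.indicator (fun k : ℕ ↦ 1 / (k : ℂ) ^ 2) = fun k : ℕ ↦ 1 / (k : ℂ) ^ 2 := by
  rw [Set.indicator_eq_self]
  intro k hk
  by_contra h
  simp_all

/-- The even factors at `z` form the full product at `z / 2`. Dividing Euler's product at `z` by it
leaves `cosh`, by the duplication formula for `sinh`. -/
lemma tprod_odd_eq_cosh {z : ℂ} (hz : Complex.sinh (Real.pi * (z / 2)) ≠ 0) :
    ∏' i, (1 + z ^ 2 * {k : ℕ | Odd k}.indicator (fun k : ℕ ↦ 1 / (k : ℂ) ^ 2) i) =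
      Complex.cosh (Real.pi * (z / 2)) := by
  set P := ∏' i, (1 + z ^ 2 * {k : ℕ | Odd k}.indicator (fun k : ℕ ↦ 1 / (k : ℂ) ^ 2) i)
  have hodd : Multipliable fun k : ℕ ↦ 1 + z ^ 2 * (1 / ((2 * k + 1 : ℕ) : ℂ) ^ 2) :=
    multipliable_one_add_of_summable (by
      have h := ((summable_norm_indicator_inv_sq Set.univ).mul_left ‖z ^ 2‖).comp_injective
        (i := fun k : ℕ ↦ 2 * k + 1) (fun a b h ↦ by simpa using h)
      simpa only [Set.indicator_univ, Function.comp_def, ← norm_mul] using h)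
  have heven : ∀ k : ℕ, 1 + z ^ 2 * (1 / ((2 * k : ℕ) : ℂ) ^ 2) =
      1 + (z / 2) ^ 2 * (1 / (k : ℂ) ^ 2) := fun k ↦ by
    push_cast
    rw [mul_pow, div_pow]
    ring
  have hP : ∏' k : ℕ, (1 + z ^ 2 * (1 / ((2 * k + 1 : ℕ) : ℂ) ^ 2)) = P := by
    have hind : ∀ k : ℕ, {k : ℕ | Odd k}.indicator (fun k : ℕ ↦ ((k : ℂ) ^ 2)⁻¹) (2 * k + 1) =
        ((2 * k + 1 : ℂ) ^ 2)⁻¹ := fun k ↦ by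
      rw [Set.indicator_of_mem (show 2 * k + 1 ∈ {k : ℕ | Odd k} from odd_two_mul_add_one k)]
      push_cast
      rfl
    have h := tprod_even_mul_odd
      (f := fun i ↦ 1 + z ^ 2 * {k : ℕ | Odd k}.indicator (fun k : ℕ ↦ 1 / (k : ℂ) ^ 2) i)
      (by simp [multipliable_one]) (by simpa [hind] using hodd)
    simpa [hind, P] using h
  have hfull := tprod_even_mul_odd (f := fun i : ℕ ↦ 1 + z ^ 2 * (1 / (i : ℂ) ^ 2))
    (by simpa only [heven] using multipliable_one_add_inv_sq ((z / 2) ^ 2)) hodd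
  simp only [heven] at hfull
  rw [hP] at hfull
  have h1 := pi_mul_tprod_one_add_inv_sq z
  have h2 := pi_mul_tprod_one_add_inv_sq (z / 2)
  have h3 : Complex.sinh (Real.pi * z) =
      2 * Complex.sinh (Real.pi * (z / 2)) * Complex.cosh (Real.pi * (z / 2)) := by
    rw [← Complex.sinh_two_mul]
    congr 1
    ring
  apply mul_left_cancel₀ hz
  rw [← hfull] at h1
  linear_combination (1 / 2) * h1 - P * h2 + (1 / 2) * h3

lemma hasSum_pos_product (x : ℂ) :
    HasSum (fun n ↦ ((Real.pi ^ (2 * n) / (2 * n + 1).factorial : ℝ) : ℂ) * x ^ n)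
      (∏' i, (1 + x * {k : ℕ | 0 < k}.indicator (fun k : ℕ ↦ 1 / (k : ℂ) ^ 2) i)) := by
  rw [indicator_pos_inv_sq]
  obtain ⟨z, rfl⟩ := IsAlgClosed.exists_pow_nat_eq x two_pos
  obtain rfl | hz := eq_or_ne z 0
  · convert hasSum_single (0 : ℕ) _ using 1
    · simp
    · intro n hn
      simp [hn]
  · have hpi : (Real.pi : ℂ) * z ≠ 0 := mul_ne_zero (mod_cast Real.pi_ne_zero) hz
    rw [← hasSum_mul_left_iff hpi, pi_mul_tprod_one_add_inv_sq]
    convert! Complex.hasSum_sinh (Real.pi * z) using 2 with n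
    push_cast
    ring

lemma hasSum_odd_product :
    ∀ᶠ x in 𝓝 (0 : ℂ),
      HasSum (fun n ↦ (((Real.pi / 2) ^ (2 * n) / (2 * n).factorial : ℝ) : ℂ) * x ^ n)
        (∏' i, (1 + x * {k : ℕ | Odd k}.indicator (fun k : ℕ ↦ 1 / (k : ℂ) ^ 2) i)) := by
  -- The zeros of `sinh (π z / 2)` are the points of `2iℤ`, so for `0 < ‖z‖ < 1` it can be
  -- cancelled.
  filter_upwards [Metric.ball_mem_nhds (0 : ℂ) one_pos] with x hx
  obtain ⟨z, rfl⟩ := IsAlgClosed.exists_pow_nat_eq x two_pos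
  obtain rfl | hz := eq_or_ne z 0
  · convert hasSum_single (0 : ℕ) _ using 1
    · simp
    · intro n hn
      simp [hn]
  · have hnorm : ‖z‖ < 1 := by
      have : ‖z‖ ^ 2 < 1 := by simpa using hx
      exact (pow_lt_one_iff_of_nonneg (norm_nonneg z) two_ne_zero).mp this
    have hsinh : Complex.sinh (Real.pi * (z / 2)) ≠ 0 := by
      intro h
      have hpi : (Real.pi : ℂ) ≠ 0 := mod_cast Real.pi_ne_zero
      have hsin : Complex.sin (Real.pi * (z / 2) * Complex.I) = 0 := by
        rw [Complex.sin_mul_I, h, zero_mul]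
      obtain ⟨k, hk⟩ := Complex.sin_eq_zero_iff.mp hsin
      have hk' : z * Complex.I = 2 * k := by
        apply mul_left_cancel₀ hpi
        linear_combination 2 * hk
      have hn : ‖z‖ = 2 * |(k : ℝ)| := by simpa using congrArg norm hk'
      obtain rfl | hk0 := eq_or_ne k 0
      · exact hz (by simpa using hk')
      · have : (1 : ℝ) ≤ |(k : ℝ)| := mod_cast Int.one_le_abs hk0
        linarith
    rw [tprod_odd_eq_cosh hsinh]
    convert Complex.hasSum_cosh (Real.pi * (z / 2)) using 2 with n
    push_cast
    ring

end MultipleValues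

theorem theorem4 (n : ℕ) (hn : 1 ≤ n) :
    (Summable (fun m : MultipleValues.decreasingTuples n =>
        MultipleValues.summand (MultipleValues.repeated 2 n) m) ∧
      MultipleValues.multipleZeta (MultipleValues.repeated 2 n) / 2 ^ (2 * n) =
        1 / ((2 * n + 1).factorial : ℝ) * (Real.pi / 2) ^ (2 * n)) ∧
    (Summable (fun m : MultipleValues.oddDecreasingTuples n =>
        MultipleValues.summand (MultipleValues.repeated 2 n) m) ∧
      MultipleValues.multipleT (MultipleValues.repeated 2 n) =
        1 / ((2 * n).factorial : ℝ) * (Real.pi / 2) ^ (2 * n)) := by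
  have hζ := MultipleValues.hasSum_summand_two
    (Filter.Eventually.of_forall MultipleValues.hasSum_pos_product) n
  have ht := MultipleValues.hasSum_summand_two MultipleValues.hasSum_odd_product n
  refine ⟨⟨hζ.summable, ?_⟩, ht.summable, ?_⟩
  · have h : MultipleValues.multipleZeta (MultipleValues.repeated 2 n) = _ := hζ.tsum_eq
    rw [h, div_pow]
    ring
  · have h : MultipleValues.multipleT (MultipleValues.repeated 2 n) = _ := ht.tsum_eq
    rw [h]
    ring
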